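/- **Conventions.** Let $F$ be a finite field with $N$ elements and characteristic $p$, and let $n\ge 0$. A linear code of length $n$ is a subspace $C\subseteq F^n$; it has parameters $[n,k,d]$ if $\dim C=k$ and $d$ is the least Hamming distance between two distinct codewords (in particular $C\ne 0$). For $S\subseteq F^n$ let $\mathrm{wt}(S)$ be the least Hamming weight of a nonzero element of $S$. Let $C^\perp=\{x:\sum_i x_ic_i=0\ \forall c\in C\}$ and, if $|F|=q^2$, $C^{\perp h}=\{x:\sum_i x_ic_i^{\,q}=0\ \forall c\in C\}$. Let $V_n=(\mathbb C^{N})^{\otimes n}$, with orthonormal basis $|c\rangle$, $c\in F^n$. For $a,b\in F^n$ let $X(a)|x\rangle=|x+a\rangle$ and $Z(b)|x\rangle=e^{2\pi i\,\mathrm{Tr}(b\cdot x)/p}|x\rangle$, where $\mathrm{Tr}$ is the trace from $F$ to $\mathbb F_p$. A subspace $Q\subseteq V_n$ detects an operator $E$ if there is $\lambda\in\mathbb C$ with $\langle\varphi|E|\psi\rangle=\lambda\langle\varphi|\psi\rangle$ for all $\varphi,\psi\in Q$. For positive integers $d_z,d_x$, an asymmetric quantum code with parameters $[[n,k,\{d_z,d_x\}]]_{N}$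 is a subspace $Q\subseteq V_n$ of dimension $N^{\,k}$ which detects every error $X(a)Z(b)$ where $a$ has Hamming weight at most $d_x-1$ and $b$ has Hamming weight at most $d_z-1$. **Lemma (CSS construction for asymmetric quantum codes).** (i) Let $F=\mathbb F_q$ and let $C_1\subsetneq C_2\subseteq \mathbb F_q^n$ be linear codes of dimensions $k_1$ and $k_2$. Then there exists an asymmetric quantum code with parameters $[[n,k_2-k_1,\{d_z,d_x\}]]_q$, where $$d_z=\max\{\mathrm{wt}(C_2\setminus C_1),\mathrm{wt}(C_1^\perp\setminus C_2^\perp)\},\qquad d_x=\min\{\mathrm{wt}(C_2\setminus C_1),\mathrm{wt}(C_1^\perp\setminus C_2^\perp)\}.$$ (ii) Let $F=\mathbb F_{q^2}$ and let $C_1,C_2\subseteq\mathbb F_{q^2}^n$ be linear codes with parameters $[n,k_1,d_1]_{q^2}$ and $[n,k_2,d_2]_{q^2}$ such that $C_1^{\perp h}\subseteq C_2$. Put $k_1^h=\dim C_1^{\perp h}$. Then, for each of the two choices of $(d_x,d_z)$ with $\{d_x,d_z\}=\{d_1,d_2\}$, there exists an asymmetric quantum code with parameters $[[n,k_2-k_1^h,\{d_z,d_x\}]]_{q^2}$.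 -/

import Mathlib

open scoped InnerProductSpace

namespace QCode

/-- `C` is a linear code with parameters `[n, k, d]` over `F`: a `k`-dimensional subspace of
`F ^ n` in which `d` is the least Hamming distance between two distinct codewords. -/
def HasParams {F : Type*} [Field F] [DecidableEq F] {n : ℕ}
    (C : Submodule F (Fin n → F)) (k d : ℕ) : Prop :=
  Module.finrank F C = k ∧
    IsLeast {m : ℕ | ∃ x ∈ C, ∃ y ∈ C, x ≠ y ∧ hammingDist x y = m} d

/-- `wt S`: the least Hamming weight of a nonzero word in `S`
(meaningful when `S` has a nonzero element). -/
noncomputable def wt {F : Type*} [Field F] [DecidableEq F] {n : ℕ}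
    (S : Set (Fin n → F)) : ℕ :=
  sInf {m : ℕ | ∃ x ∈ S, x ≠ 0 ∧ hammingNorm x = m}

/-- The Euclidean dual code: all `x` with `∑ i, x i * c i = 0` for every `c ∈ C`. -/
def dual {F : Type*} [Field F] {n : ℕ} (C : Submodule F (Fin n → F)) :
    Submodule F (Fin n → F) where
  carrier := {x | ∀ c ∈ C, ∑ i, x i * c i = 0}
  zero_mem' := by intro c _; simp
  add_mem' := by
    intro x y hx hy c hc
    simp [add_mul, Finset.sum_add_distrib, hx c hc, hy c hc]
  smul_mem' := by
    intro r x hx c hc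
    simp [mul_assoc, ← Finset.mul_sum, hx c hc]

/-- The Hermitian dual of a code over the field with `q ^ 2` elements:
all `x` with `∑ i, x i * (c i) ^ q = 0` for every `c ∈ C`. -/
def hermitianDual {F : Type*} [Field F] {n : ℕ} (q : ℕ) (C : Submodule F (Fin n → F)) :
    Submodule F (Fin n → F) where
  carrier := {x | ∀ c ∈ C, ∑ i, x i * (c i) ^ q = 0}
  zero_mem' := by intro c _; simp
  add_mem' := by
    intro x y hx hy c hc
    simp [add_mul, Finset.sum_add_distrib, hx c hc, hy c hc]
  smul_mem' := by
    intro r x hx c hc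
    simp [mul_assoc, ← Finset.mul_sum, hx c hc]

/-- The state space `V_n = (ℂ ^ q) ^ {⊗ n} = ℂ ^ (q ^ n)`, with orthonormal basis `|c⟩`,
`c ∈ F ^ n`, where `q` is the number of elements of `F`. -/
abbrev StateSpace (F : Type*) [Field F] [Fintype F] (n : ℕ) : Type _ :=
  EuclideanSpace ℂ (Fin n → F)

/-- The additive character `x ↦ exp (2 π i Tr(x) / p)` of a finite field of characteristic `p`,
where `Tr` is the trace to the prime field. -/
noncomputable def traceChar {F : Type*} [Field F] [Fintype F] (x : F) : ℂ :=
  letI : Algebra (ZMod (ringChar F)) F := ZMod.algebra F (ringChar F)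
  haveI : NeZero (ringChar F) := ⟨CharP.ringChar_ne_zero_of_finite F⟩
  ZMod.stdAddChar (Algebra.trace (ZMod (ringChar F)) F x)

/-- The operator `X(a) : |x⟩ ↦ |x + a⟩`. -/
noncomputable def errX {F : Type*} [Field F] [Fintype F] {n : ℕ} (a : Fin n → F) :
    StateSpace F n →ₗ[ℂ] StateSpace F n where
  toFun φ := WithLp.toLp 2 fun x => φ (x - a)
  map_add' := by intro φ ψ; ext x; simp
  map_smul' := by intro r φ; ext x; simp

/-- The operator `Z(b) : |x⟩ ↦ exp (2 π i Tr(b · x) / p) |x⟩`. -/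
noncomputable def errZ {F : Type*} [Field F] [Fintype F] {n : ℕ} (b : Fin n → F) :
    StateSpace F n →ₗ[ℂ] StateSpace F n where
  toFun φ := WithLp.toLp 2 fun x => traceChar (∑ i, b i * x i) * φ x
  map_add' := by intro φ ψ; ext x; simp [mul_add]
  map_smul' := by intro r φ; ext x; simp [mul_left_comm]

/-- The quantum code `Q` detects the error `E` (the Knill-Laflamme condition `P E P = c P`,
with `P` the orthogonal projection onto `Q`). -/
def Detects {F : Type*} [Field F] [Fintype F] {n : ℕ} (Q : Submodule ℂ (StateSpace F n))
    (E : StateSpace F n →ₗ[ℂ] StateSpace F n) : Prop :=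
  ∃ c : ℂ, ∀ φ ∈ Q, ∀ ψ ∈ Q, ⟪φ, E ψ⟫_ℂ = c * ⟪φ, ψ⟫_ℂ

/-- `Q` is an asymmetric quantum code with parameters `[[n, k, {dz, dx}]]_q`, where `q` is the
number of elements of `F`: it has dimension `q ^ k` and detects every error `X(a) Z(b)` whose
`X`-part affects at most `dx - 1` positions and whose `Z`-part at most `dz - 1` positions. -/
def IsAQC {F : Type*} [Field F] [Fintype F] [DecidableEq F] {n : ℕ}
    (Q : Submodule ℂ (StateSpace F n)) (k dz dx : ℕ) : Prop :=
  0 < dz ∧ 0 < dx ∧ Module.finrank ℂ Q = Fintype.card F ^ k ∧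
    ∀ a b : Fin n → F, hammingNorm a ≤ dx - 1 → hammingNorm b ≤ dz - 1 →
      Detects Q (errX a ∘ₗ errZ b)

end QCode

open scoped InnerProductSpace

namespace QCode

/-! ### Euclidean duality of codes. -/

section Dual

variable {F : Type*} [Field F] {n : ℕ}

/-! For `C₁ ≤ C₂`, the states supported on `C₂` and constant on cosets of `C₁` form a space of
dimension `|C₂ / C₁|`. An error X(a)Z(b) with `a ∉ C₂` or `b ∉ dual C₁` has all matrix elements zero
on it; one with `a ∈ C₁` and `b ∈ dual C₂` fixes it pointwise. So an undetected error needs `a ∈ C₂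
\ C₁` or `b ∈ dual C₁ \ dual C₂`, which the weight bounds forbid.

The pair `dual C₂ ≤ dual C₁` exchanges the two distances without changing the dimension, so either
order is available. For the Hermitian case, the Hermitian dual of `C₁` is the Euclidean dual of its
conjugate under x ↦ x ^ q; hence its Euclidean dual is that conjugate, whose weights are those of
`C₁`. -/

theorem mem_dual {C : Submodule F (Fin n → F)} {x : Fin n → F} :
    x ∈ dual C ↔ ∀ c ∈ C, ∑ i, x i * c i = 0 :=
  Iff.rfl

theorem dotProductBilin_isRefl :
    LinearMap.BilinForm.IsRefl (dotProductBilin F F : LinearMap.BilinForm F (Fin n → F)) := by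
  intro x y h
  simpa [dotProduct_comm] using h

theorem dotProductBilin_nondegenerate :
    (dotProductBilin F F : LinearMap.BilinForm F (Fin n → F)).Nondegenerate := by
  apply LinearMap.BilinForm.Nondegenerate.ofSeparatingLeft
  intro x hx
  exact dotProduct_eq_zero x hx

theorem dual_eq_orthogonal (C : Submodule F (Fin n → F)) :
    dual C = LinearMap.BilinForm.orthogonal (dotProductBilin F F) C := by
  ext x
  rw [mem_dual, LinearMap.BilinForm.mem_orthogonal_iff]
  refine forall₂_congr fun c _ => ?_
  simp [dotProduct, mul_comm]

theorem dual_dual (C : Submodule F (Fin n → F)) : dual (dual C) = C := by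
  rw [dual_eq_orthogonal, dual_eq_orthogonal]
  exact LinearMap.BilinForm.orthogonal_orthogonal dotProductBilin_nondegenerate
    dotProductBilin_isRefl C

theorem finrank_dual (C : Submodule F (Fin n → F)) :
    Module.finrank F (dual C) = n - Module.finrank F C := by
  rw [dual_eq_orthogonal, LinearMap.BilinForm.finrank_orthogonal dotProductBilin_nondegenerate,
    Module.finrank_fin_fun]

theorem dual_anti {C D : Submodule F (Fin n → F)} (h : C ≤ D) : dual D ≤ dual C :=
  fun _ hx c hc => hx c (h hc)

theorem finrank_le_length (C : Submodule F (Fin n → F)) : Module.finrank F C ≤ n := by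
  simpa using Submodule.finrank_le C

end Dual

/-! ### The trace character. -/

section TraceChar

variable {F : Type*} [Field F] [Fintype F]

theorem traceChar_zero : traceChar (0 : F) = 1 := by
  simp [traceChar]

theorem traceChar_add (x y : F) : traceChar (x + y) = traceChar x * traceChar y := by
  simp [traceChar, AddChar.map_add_eq_mul]

/-- The trace form is nondegenerate and the standard character of the prime field is injective. -/
theorem exists_traceChar_mul_ne_one {a : F} (ha : a ≠ 0) : ∃ r : F, traceChar (r * a) ≠ 1 := by
  let _ : Algebra (ZMod (ringChar F)) F := ZMod.algebra F (ringChar F)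
  have : NeZero (ringChar F) := ⟨CharP.ringChar_ne_zero_of_finite F⟩
  obtain ⟨r, hr⟩ := FiniteField.trace_to_zmod_nondegenerate F ha
  refine ⟨r, fun h => hr (ZMod.injective_stdAddChar ?_)⟩
  rw [AddChar.map_zero_eq_one, mul_comm]
  exact h

end TraceChar

/-! ### The CSS code and its errors. -/

section CSS

variable {F : Type*} [Field F] [Fintype F] {n : ℕ}

open Classical in
/-- Extension of a function on `C₂ / C₁` to a state: the value at `|x⟩` is the value at the class
of `x` if `x ∈ C₂`, and `0` otherwise. -/
noncomputable def cosetState (C₁ C₂ : Submodule F (Fin n → F)) :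
    (C₂ ⧸ C₁.submoduleOf C₂ → ℂ) →ₗ[ℂ] StateSpace F n where
  toFun f := WithLp.toLp 2 fun x => if h : x ∈ C₂ then f (Submodule.Quotient.mk ⟨x, h⟩) else 0
  map_add' f g := by
    ext x
    by_cases h : x ∈ C₂ <;> simp [h]
  map_smul' r f := by
    ext x
    by_cases h : x ∈ C₂ <;> simp [h]

theorem cosetState_apply_of_mem (C₁ : Submodule F (Fin n → F)) {C₂ : Submodule F (Fin n → F)}
    (f : C₂ ⧸ C₁.submoduleOf C₂ → ℂ) {x : Fin n → F} (h : x ∈ C₂) :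
    cosetState C₁ C₂ f x = f (Submodule.Quotient.mk ⟨x, h⟩) := by
  simp [cosetState, h]

theorem cosetState_apply_of_notMem (C₁ : Submodule F (Fin n → F))
    {C₂ : Submodule F (Fin n → F)} (f : C₂ ⧸ C₁.submoduleOf C₂ → ℂ) {x : Fin n → F}
    (h : x ∉ C₂) : cosetState C₁ C₂ f x = 0 := by
  simp [cosetState, h]

theorem cosetState_injective (C₁ C₂ : Submodule F (Fin n → F)) :
    Function.Injective (cosetState C₁ C₂) := by
  intro f g hfg
  funext y
  obtain ⟨⟨x, hx⟩, rfl⟩ := Submodule.Quotient.mk_surjective _ y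
  rw [← cosetState_apply_of_mem C₁ f hx, hfg, cosetState_apply_of_mem C₁ g hx]

/-- The CSS code of a nested pair `C₁ ≤ C₂`: the span of the uniform superpositions of the
cosets of `C₁` in `C₂`. -/
noncomputable def cssCode (C₁ C₂ : Submodule F (Fin n → F)) : Submodule ℂ (StateSpace F n) :=
  LinearMap.range (cosetState C₁ C₂)

variable {C₁ C₂ : Submodule F (Fin n → F)}

theorem finrank_cssCode (h : C₁ ≤ C₂) :
    Module.finrank ℂ (cssCode C₁ C₂) =
      Fintype.card F ^ (Module.finrank F C₂ - Module.finrank F C₁) := by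
  classical
  let _ : Fintype (C₂ ⧸ C₁.submoduleOf C₂) := Fintype.ofFinite _
  rw [cssCode, LinearMap.finrank_range_of_inj (cosetState_injective C₁ C₂),
    Module.finrank_fintype_fun_eq_card, Module.card_eq_pow_finrank (K := F)]
  congr 1
  have h₁ := Submodule.finrank_quotient_add_finrank (C₁.submoduleOf C₂)
  rw [(Submodule.submoduleOfEquivOfLe h).finrank_eq] at h₁
  omega

theorem cssCode_apply_of_notMem {φ : StateSpace F n} (hφ : φ ∈ cssCode C₁ C₂) {x : Fin n → F}
    (hx : x ∉ C₂) : φ x = 0 := by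
  obtain ⟨f, rfl⟩ := hφ
  exact cosetState_apply_of_notMem C₁ f hx

theorem cssCode_apply_add (h : C₁ ≤ C₂) {φ : StateSpace F n} (hφ : φ ∈ cssCode C₁ C₂)
    (x : Fin n → F) {c : Fin n → F} (hc : c ∈ C₁) : φ (x + c) = φ x := by
  obtain ⟨f, rfl⟩ := hφ
  by_cases hx : x ∈ C₂
  · rw [cosetState_apply_of_mem C₁ f hx, cosetState_apply_of_mem C₁ f (C₂.add_mem hx (h hc))]
    congr 1
    rw [Submodule.Quotient.eq]
    simpa [Submodule.submoduleOf] using hc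
  · rw [cosetState_apply_of_notMem C₁ f hx, cosetState_apply_of_notMem]
    rwa [Submodule.add_mem_iff_left _ (h hc)]

theorem inner_errX_errZ (a b : Fin n → F) (φ ψ : StateSpace F n) :
    ⟪φ, (errX a ∘ₗ errZ b) ψ⟫_ℂ =
      ∑ x, (starRingEnd ℂ) (φ x) * (traceChar (∑ i, b i * (x - a) i) * ψ (x - a)) := by
  rw [PiLp.inner_apply]
  refine Finset.sum_congr rfl fun x _ => ?_
  rw [RCLike.inner_apply, mul_comm]
  rfl

/-- The shift by `a` moves the support `C₂` to a disjoint coset. -/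
theorem inner_errX_errZ_of_notMem {φ ψ : StateSpace F n} (hφ : φ ∈ cssCode C₁ C₂)
    (hψ : ψ ∈ cssCode C₁ C₂) {a : Fin n → F} (ha : a ∉ C₂) (b : Fin n → F) :
    ⟪φ, (errX a ∘ₗ errZ b) ψ⟫_ℂ = 0 := by
  rw [inner_errX_errZ]
  refine Finset.sum_eq_zero fun x _ => ?_
  by_cases hx : x ∈ C₂
  · have hxa : x - a ∉ C₂ := fun h => ha (by simpa using C₂.sub_mem hx h)
    rw [cssCode_apply_of_notMem hψ hxa]
    simp
  · rw [cssCode_apply_of_notMem hφ hx]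
    simp

/-- Translating the summation variable by `r • c ∈ C₁` leaves both states unchanged but multiplies
the sum by a character value other than 1, so the sum vanishes. -/
theorem inner_errX_errZ_of_notMem_dual (h : C₁ ≤ C₂) {φ ψ : StateSpace F n}
    (hφ : φ ∈ cssCode C₁ C₂) (hψ : ψ ∈ cssCode C₁ C₂) (a : Fin n → F) {b : Fin n → F}
    (hb : b ∉ dual C₁) : ⟪φ, (errX a ∘ₗ errZ b) ψ⟫_ℂ = 0 := by
  rw [mem_dual] at hb
  push Not at hb
  obtain ⟨c, hc, hbc⟩ := hb
  obtain ⟨r, hr⟩ := exists_traceChar_mul_ne_one hbc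
  have hrc : r • c ∈ C₁ := C₁.smul_mem r hc
  have key : ⟪φ, (errX a ∘ₗ errZ b) ψ⟫_ℂ =
      traceChar (r * ∑ i, b i * c i) * ⟪φ, (errX a ∘ₗ errZ b) ψ⟫_ℂ := by
    conv_lhs => rw [inner_errX_errZ, ← Equiv.sum_comp (Equiv.addRight (r • c))]
    rw [inner_errX_errZ, Finset.mul_sum]
    refine Finset.sum_congr rfl fun x _ => ?_
    have h₁ : x + r • c - a = x - a + r • c := by abel
    have h₂ : ∑ i, b i * (x - a + r • c) i =
        ∑ i, b i * (x - a) i + r * ∑ i, b i * c i := by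
      rw [Finset.mul_sum, ← Finset.sum_add_distrib]
      refine Finset.sum_congr rfl fun i _ => ?_
      simp only [Pi.add_apply, Pi.smul_apply, smul_eq_mul]
      ring
    rw [Equiv.coe_addRight, h₁, h₂, cssCode_apply_add h hφ x hrc,
      cssCode_apply_add h hψ (x - a) hrc, traceChar_add]
    ring
  by_contra hne
  exact hr (mul_right_cancel₀ hne (by rw [one_mul, ← key]))

theorem inner_errX_errZ_of_mem (h : C₁ ≤ C₂) {φ ψ : StateSpace F n} (hψ : ψ ∈ cssCode C₁ C₂)
    {a b : Fin n → F} (ha : a ∈ C₁) (hb : b ∈ dual C₂) :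
    ⟪φ, (errX a ∘ₗ errZ b) ψ⟫_ℂ = ⟪φ, ψ⟫_ℂ := by
  rw [inner_errX_errZ, PiLp.inner_apply]
  refine Finset.sum_congr rfl fun x _ => ?_
  have hψx : ψ (x - a) = ψ x := by
    rw [sub_eq_add_neg, cssCode_apply_add h hψ x (C₁.neg_mem ha)]
  rw [RCLike.inner_apply, mul_comm (ψ x)]
  congr 1
  by_cases hx : x ∈ C₂
  · rw [hψx, mem_dual.1 hb _ (C₂.sub_mem hx (h ha)), traceChar_zero, one_mul]
  · rw [hψx, cssCode_apply_of_notMem hψ hx, mul_zero]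

theorem cssCode_isAQC [DecidableEq F] (h : C₁ ≤ C₂) {dx dz : ℕ} (hdx : 0 < dx) (hdz : 0 < dz)
    (hx : ∀ a ∈ C₂, a ∉ C₁ → dx ≤ hammingNorm a)
    (hz : ∀ b ∈ dual C₁, b ∉ dual C₂ → dz ≤ hammingNorm b) :
    IsAQC (cssCode C₁ C₂) (Module.finrank F C₂ - Module.finrank F C₁) dz dx := by
  refine ⟨hdz, hdx, finrank_cssCode h, fun a b ha hb => ?_⟩
  by_cases ha₂ : a ∈ C₂
  · by_cases hb₁ : b ∈ dual C₁
    · have ha₁ : a ∈ C₁ := by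
        by_contra hn
        -- Positivity of `dx` matters here: `dx - 1` is a truncated subtraction.
        have := hx a ha₂ hn
        omega
      have hb₂ : b ∈ dual C₂ := by
        by_contra hn
        have := hz b hb₁ hn
        omega
      exact ⟨1, fun φ _ ψ hψ => by rw [inner_errX_errZ_of_mem h hψ ha₁ hb₂, one_mul]⟩
    · exact ⟨0, fun φ hφ ψ hψ => by
        rw [inner_errX_errZ_of_notMem_dual h hφ hψ a hb₁, zero_mul]⟩
  · exact ⟨0, fun φ hφ ψ hψ => by rw [inner_errX_errZ_of_notMem hφ hψ ha₂ b, zero_mul]⟩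

/-- The CSS code of the dual pair has the roles of the two distances exchanged. -/
theorem cssCode_dual_isAQC [DecidableEq F] (h : C₁ ≤ C₂) {dx dz : ℕ} (hdx : 0 < dx)
    (hdz : 0 < dz) (hz : ∀ a ∈ C₂, a ∉ C₁ → dz ≤ hammingNorm a)
    (hx : ∀ b ∈ dual C₁, b ∉ dual C₂ → dx ≤ hammingNorm b) :
    IsAQC (cssCode (dual C₂) (dual C₁)) (Module.finrank F C₂ - Module.finrank F C₁) dz dx := by
  have h₁ := cssCode_isAQC (dual_anti h) hdx hdz hx (by simpa only [dual_dual] using hz)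
  -- Needed so that the truncated differences n - dim cancel correctly.
  have h₂ := finrank_le_length C₂
  have h₃ : Module.finrank F (dual C₁) - Module.finrank F (dual C₂) =
      Module.finrank F C₂ - Module.finrank F C₁ := by
    rw [finrank_dual, finrank_dual]
    omega
  rwa [h₃] at h₁

end CSS

/-! ### Weights and minimum distance. -/

section Weight

variable {F : Type*} [Field F] [DecidableEq F] {n : ℕ}

theorem wt_le {S : Set (Fin n → F)} {x : Fin n → F} (hx : x ∈ S) (h0 : x ≠ 0) :
    wt S ≤ hammingNorm x :=
  Nat.sInf_le ⟨x, hx, h0, rfl⟩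

theorem wt_pos {S : Set (Fin n → F)} {x : Fin n → F} (hx : x ∈ S) (h0 : x ≠ 0) : 0 < wt S := by
  obtain ⟨y, -, hy, hyn⟩ := Nat.sInf_mem
    (⟨_, x, hx, h0, rfl⟩ : {m : ℕ | ∃ x ∈ S, x ≠ 0 ∧ hammingNorm x = m}.Nonempty)
  have h := hammingNorm_pos_iff.2 hy
  rwa [hyn] at h

theorem wt_diff_le {C D : Submodule F (Fin n → F)} {x : Fin n → F} (hC : x ∈ C) (hD : x ∉ D) :
    wt ((C : Set (Fin n → F)) \ D) ≤ hammingNorm x :=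
  wt_le ⟨hC, hD⟩ fun h => hD (h ▸ D.zero_mem)

theorem wt_diff_pos {C D : Submodule F (Fin n → F)} (h : ¬C ≤ D) :
    0 < wt ((C : Set (Fin n → F)) \ D) := by
  obtain ⟨x, hC, hD⟩ := SetLike.not_le_iff_exists.1 h
  exact wt_pos (⟨hC, hD⟩ : x ∈ (C : Set (Fin n → F)) \ D) fun h => hD (h ▸ D.zero_mem)

theorem HasParams.le_hammingNorm {C : Submodule F (Fin n → F)} {k d : ℕ} (h : HasParams C k d)
    {x : Fin n → F} (hx : x ∈ C) (h0 : x ≠ 0) : d ≤ hammingNorm x :=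
  h.2.2 ⟨x, hx, 0, C.zero_mem, h0, hammingDist_zero_right x⟩

theorem HasParams.pos {C : Submodule F (Fin n → F)} {k d : ℕ} (h : HasParams C k d) : 0 < d := by
  obtain ⟨x, -, y, -, hne, rfl⟩ := h.2.1
  exact hammingDist_pos.2 hne

theorem hammingNorm_pow {q : ℕ} (hq : q ≠ 0) (x : Fin n → F) :
    hammingNorm (x ^ q) = hammingNorm x := by
  simp [hammingNorm, hq]

end Weight

/-! ### Reducing Hermitian duality to Euclidean duality. -/

section Hermitian

variable {F : Type*} [Field F] [Fintype F] {n : ℕ}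

/-- Since `q` divides a power of the characteristic, it is itself such a power, and x ↦ x ^ q is an
iterate of Frobenius. -/
theorem add_pow_of_card_eq_sq {q : ℕ} (hq : Fintype.card F = q ^ 2) (x y : F) :
    (x + y) ^ q = x ^ q + y ^ q := by
  obtain ⟨m, hp, hm⟩ := FiniteField.card F (ringChar F)
  have : Fact (ringChar F).Prime := ⟨hp⟩
  have hdvd : q ∣ ringChar F ^ (m : ℕ) := by
    rw [← hm, hq]
    exact dvd_pow_self q two_ne_zero
  obtain ⟨k, -, rfl⟩ := (Nat.dvd_prime_pow hp).1 hdvd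
  exact add_pow_char_pow x y _ _

/-- The image of a code under the coordinatewise conjugation `x ↦ x ^ q`. -/
def conjCode {q : ℕ} (hq : Fintype.card F = q ^ 2) (C : Submodule F (Fin n → F)) :
    Submodule F (Fin n → F) where
  carrier := {x | ∃ c ∈ C, c ^ q = x}
  zero_mem' := ⟨0, C.zero_mem, zero_pow (by
    rintro rfl
    exact Fintype.card_ne_zero hq)⟩
  add_mem' := by
    rintro _ _ ⟨c, hc, rfl⟩ ⟨d, hd, rfl⟩
    exact ⟨c + d, C.add_mem hc hd, funext fun i => add_pow_of_card_eq_sq hq (c i) (d i)⟩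
  smul_mem' := by
    rintro r _ ⟨c, hc, rfl⟩
    -- Conjugation is an involution on scalars: (r ^ q) ^ q = r.
    refine ⟨r ^ q • c, C.smul_mem _ hc, funext fun i => ?_⟩
    simp only [Pi.pow_apply, Pi.smul_apply, smul_eq_mul, mul_pow, ← pow_mul]
    rw [← sq, ← hq, FiniteField.pow_card]

theorem hermitianDual_eq_dual_conjCode {q : ℕ} (hq : Fintype.card F = q ^ 2)
    (C : Submodule F (Fin n → F)) : hermitianDual q C = dual (conjCode hq C) := by
  ext x
  constructor
  · rintro h _ ⟨c, hc, rfl⟩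
    exact h c hc
  · intro h c hc
    exact h _ ⟨c, hc, rfl⟩

theorem HasParams.le_hammingNorm_of_mem_dual_hermitianDual [DecidableEq F] {q : ℕ}
    (hq : Fintype.card F = q ^ 2) {C : Submodule F (Fin n → F)} {k d : ℕ} (h : HasParams C k d)
    {x : Fin n → F} (hx : x ∈ dual (hermitianDual q C)) (h0 : x ≠ 0) : d ≤ hammingNorm x := by
  have hq0 : q ≠ 0 := by
    rintro rfl
    exact Fintype.card_ne_zero hq
  rw [hermitianDual_eq_dual_conjCode hq, dual_dual] at hx
  obtain ⟨c, hc, rfl⟩ := hx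
  rw [hammingNorm_pow hq0]
  refine h.le_hammingNorm hc ?_
  rintro rfl
  exact h0 (zero_pow hq0)

end Hermitian

end QCode

theorem mainTheorem1 :
    -- (i) the standard (Euclidean) construction
    (∀ (F : Type*) [Field F] [Fintype F] [DecidableEq F] (n k₁ k₂ : ℕ)
        (C₁ C₂ : Submodule F (Fin n → F)),
      Module.finrank F C₁ = k₁ → Module.finrank F C₂ = k₂ → C₁ < C₂ →
      ∃ Q : Submodule ℂ (QCode.StateSpace F n),
        QCode.IsAQC Q (k₂ - k₁)
          (max (QCode.wt ((C₂ : Set (Fin n → F)) \ C₁))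
            (QCode.wt ((QCode.dual C₁ : Set (Fin n → F)) \ QCode.dual C₂)))
          (min (QCode.wt ((C₂ : Set (Fin n → F)) \ C₁))
            (QCode.wt ((QCode.dual C₁ : Set (Fin n → F)) \ QCode.dual C₂)))) ∧
    -- (ii) the Hermitian construction
    (∀ (q : ℕ) (F : Type*) [Field F] [Fintype F] [DecidableEq F], Fintype.card F = q ^ 2 →
      ∀ (n k₁ k₂ d₁ d₂ k₁h : ℕ) (C₁ C₂ : Submodule F (Fin n → F)),
      QCode.HasParams C₁ k₁ d₁ → QCode.HasParams C₂ k₂ d₂ →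
      Module.finrank F (QCode.hermitianDual q C₁) = k₁h →
      QCode.hermitianDual q C₁ ≤ C₂ →
      ∀ dx dz : ℕ, ({dx, dz} : Set ℕ) = {d₁, d₂} →
      ∃ Q : Submodule ℂ (QCode.StateSpace F n), QCode.IsAQC Q (k₂ - k₁h) dz dx) := by
  refine ⟨?_, ?_⟩
  · rintro F _ _ _ n _ _ C₁ C₂ rfl rfl hlt
    have hA := QCode.wt_diff_pos hlt.not_ge
    have hB : 0 < QCode.wt ((QCode.dual C₁ : Set (Fin n → F)) \ QCode.dual C₂) := by
      refine QCode.wt_diff_pos fun h => hlt.not_ge ?_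
      simpa only [QCode.dual_dual] using QCode.dual_anti h
    rcases le_total (QCode.wt ((C₂ : Set (Fin n → F)) \ C₁))
      (QCode.wt ((QCode.dual C₁ : Set (Fin n → F)) \ QCode.dual C₂)) with hAB | hBA
    · rw [max_eq_right hAB, min_eq_left hAB]
      exact ⟨_, QCode.cssCode_isAQC hlt.le hA hB (fun _ => QCode.wt_diff_le)
        (fun _ => QCode.wt_diff_le)⟩
    · rw [max_eq_left hBA, min_eq_right hBA]
      exact ⟨_, QCode.cssCode_dual_isAQC hlt.le hB hA (fun _ => QCode.wt_diff_le)
        (fun _ => QCode.wt_diff_le)⟩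
  · rintro q F _ _ _ hq n _ _ d₁ d₂ _ C₁ C₂ h₁ h₂ rfl hle dx dz hd
    obtain rfl := h₂.1
    have hC₂ : ∀ a ∈ C₂, a ∉ QCode.hermitianDual q C₁ → d₂ ≤ hammingNorm a := fun a ha hn =>
      h₂.le_hammingNorm ha fun h => hn (h ▸ Submodule.zero_mem _)
    have hC₁ : ∀ b ∈ QCode.dual (QCode.hermitianDual q C₁), b ∉ QCode.dual C₂ →
        d₁ ≤ hammingNorm b := fun b hb hn =>
      h₁.le_hammingNorm_of_mem_dual_hermitianDual hq hb fun h => hn (h ▸ Submodule.zero_mem _)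
    -- The pair used is the Hermitian dual of `C₁` inside `C₂`; equality is allowed, since the
    -- distances need only be lower bounds.
    rcases Set.pair_eq_pair_iff.1 hd with ⟨rfl, rfl⟩ | ⟨rfl, rfl⟩
    · exact ⟨_, QCode.cssCode_dual_isAQC hle h₁.pos h₂.pos hC₂ hC₁⟩
    · exact ⟨_, QCode.cssCode_isAQC hle h₂.pos h₁.pos hC₂ hC₁⟩
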